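/- Let $d\ge 1$ and let $\Omega\subset\mathbb R^d$ be a bounded open set. Let $H_0^1(\Omega)$ be the closure of $C_c^\infty(\Omega)$ in the $H^1(\Omega)$-norm, $H^{-1}(\Omega)$ its dual with dual pairing $\langle\cdot,\cdot\rangle$, and $a(y,v)=\int_\Omega \nabla y\cdot\nabla v\,dx$. Let $(u_\gamma)\subset H^{-1}(\Omega)$ be a family (or a sequence $u_{\gamma_n}$ with $\gamma_n\to\infty$) such that $u_\gamma\to u$ in $H^{-1}(\Omega)$ as $\gamma\to\infty$. For these $\gamma$ let $y_\gamma\in H_0^1(\Omega)$ be the solution of $$a(y_\gamma,v)+\frac2\pi\int_\Omega\arctan(\gamma y_\gamma)\,v\,dx=\langle u_\gamma,v\rangle\qquad\forall v\in H_0^1(\Omega),$$ and let $y\in H_0^1(\Omega)$ be the solution of the variational inequality $$a(y,v-y)+\|v\|_{L^1(\Omega)}-\|y\|_{L^1(\Omega)}\ge\langle u,v-y\rangle\qquad\forall v\in H_0^1(\Omega).$$ Then $y_\gamma\to y$ strongly in $H_0^1(\Omega)$ as $\gamma\to\infty$. -/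

import Mathlib

open MeasureTheory Filter Topology
open scoped ContDiff Gradient

noncomputable section

namespace SemilinearVI

/-- The Hilbert space `L²(Ω) × L²(Ω)ᵈ` with the norm `(‖f‖² + ‖g‖²)^(1/2)`.  A function `y` of
`H¹(Ω)` is represented in it by the pair `(y, ∇y)`, whose norm is the usual `H¹(Ω)`-norm of `y`. -/
abbrev L2Pair {d : ℕ} (Ω : Set (EuclideanSpace ℝ (Fin d))) : Type :=
  WithLp 2 (Lp ℝ 2 (volume.restrict Ω) × Lp (EuclideanSpace ℝ (Fin d)) 2 (volume.restrict Ω))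

/-- The pairs `(φ, ∇φ)` with a test function `φ ∈ C_c^∞(Ω)`. -/
def testPairs {d : ℕ} (Ω : Set (EuclideanSpace ℝ (Fin d))) : Submodule ℝ (L2Pair Ω) where
  carrier := {w | ∃ φ : EuclideanSpace ℝ (Fin d) → ℝ,
    ContDiff ℝ ∞ φ ∧ HasCompactSupport φ ∧ tsupport φ ⊆ Ω ∧
      w.fst =ᵐ[volume.restrict Ω] φ ∧ w.snd =ᵐ[volume.restrict Ω] ∇ φ}
  add_mem' := by
    rintro w z ⟨φ, hφ, hφc, hφs, hw1, hw2⟩ ⟨ψ, hψ, hψc, hψs, hz1, hz2⟩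
    refine ⟨φ + ψ, hφ.add hψ, hφc.add hψc,
      (tsupport_add φ ψ).trans (Set.union_subset hφs hψs), ?_, ?_⟩
    · filter_upwards [Lp.coeFn_add w.fst z.fst, hw1, hz1] with x hx h1 h2
      simpa [h1, h2] using hx
    · filter_upwards [Lp.coeFn_add w.snd z.snd, hw2, hz2] with x hx h1 h2
      have e : ∇ (φ + ψ) x = ∇ φ x + ∇ ψ x := by
        simp [gradient, fderiv_add (hφ.differentiable (by simp) x)
          (hψ.differentiable (by simp) x)]
      rw [e, ← h1, ← h2]
      simpa using hx
  zero_mem' := by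
    refine ⟨0, contDiff_const, HasCompactSupport.zero, by simp [tsupport], ?_, ?_⟩
    · exact Lp.coeFn_zero _ _ _
    · filter_upwards [Lp.coeFn_zero (EuclideanSpace ℝ (Fin d)) 2 (volume.restrict Ω)] with x hx
      have e : ∇ (0 : EuclideanSpace ℝ (Fin d) → ℝ) x = 0 := by simp [gradient]
      rw [e]
      simpa using hx
  smul_mem' := by
    rintro c w ⟨φ, hφ, hφc, hφs, hw1, hw2⟩
    refine ⟨c • φ, contDiff_const.smul hφ, hφc.smul_left,
      (closure_mono (Function.support_const_smul_subset c φ)).trans hφs, ?_, ?_⟩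
    · filter_upwards [Lp.coeFn_smul c w.fst, hw1] with x hx h1
      simpa [h1] using hx
    · filter_upwards [Lp.coeFn_smul c w.snd, hw2] with x hx h1
      have e : ∇ (c • φ) x = c • ∇ φ x := by
        simp [gradient, fderiv_const_smul (hφ.differentiable (by simp) x)]
      rw [e, ← h1]
      simpa using hx

/-- The Sobolev space `H₀¹(Ω)`: the closure of `C_c^∞(Ω)` with respect to the `H¹(Ω)`-norm. -/
def H10 {d : ℕ} (Ω : Set (EuclideanSpace ℝ (Fin d))) : Submodule ℝ (L2Pair Ω) :=
  (testPairs Ω).topologicalClosure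

/-- The function in `L²(Ω)` underlying an element of `H₀¹(Ω)`. -/
def fn {d : ℕ} {Ω : Set (EuclideanSpace ℝ (Fin d))} (y : H10 Ω) :
    Lp ℝ 2 (volume.restrict Ω) :=
  (y : L2Pair Ω).fst

/-- The weak gradient in `L²(Ω)ᵈ` of an element of `H₀¹(Ω)`. -/
def weakGrad {d : ℕ} {Ω : Set (EuclideanSpace ℝ (Fin d))} (y : H10 Ω) :
    Lp (EuclideanSpace ℝ (Fin d)) 2 (volume.restrict Ω) :=
  (y : L2Pair Ω).snd

/-- The dual space `H⁻¹(Ω)` of `H₀¹(Ω)`, with the dual norm. -/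
abbrev Hm1 {d : ℕ} (Ω : Set (EuclideanSpace ℝ (Fin d))) : Type :=
  H10 Ω →L[ℝ] ℝ

/-- The bilinear form `a(y, v) = (∇y, ∇v)`. -/
def dirichletForm {d : ℕ} {Ω : Set (EuclideanSpace ℝ (Fin d))} (y v : H10 Ω) : ℝ :=
  ∫ x in Ω, inner ℝ (weakGrad y x) (weakGrad v x)

/-- The norm of `L¹(Ω)`. -/
def l1Norm {d : ℕ} {Ω : Set (EuclideanSpace ℝ (Fin d))} (y : H10 Ω) : ℝ :=
  ∫ x in Ω, |fn y x|

/-- `y` solves the variational inequality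
`a(y, v - y) + ‖v‖_{L¹(Ω)} - ‖y‖_{L¹(Ω)} ≥ ⟨u, v - y⟩` for all `v ∈ H₀¹(Ω)`. -/
def IsVISolution {d : ℕ} {Ω : Set (EuclideanSpace ℝ (Fin d))} (u : Hm1 Ω) (y : H10 Ω) : Prop :=
  ∀ v : H10 Ω, u (v - y) ≤ dirichletForm y (v - y) + l1Norm v - l1Norm y

/-- The smoothed sign `β_γ(s) = (2/π) arctan(γ s)`. -/
def beta (γ s : ℝ) : ℝ := 2 / Real.pi * Real.arctan (γ * s)

/-- `y` solves the regularized equation `a(y, v) + (β_γ(y), v) = ⟨u, v⟩` for all `v ∈ H₀¹(Ω)`. -/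
def IsRegularizedSolution {d : ℕ} {Ω : Set (EuclideanSpace ℝ (Fin d))} (γ : ℝ) (u : Hm1 Ω)
    (y : H10 Ω) : Prop :=
  ∀ v : H10 Ω, dirichletForm y v + (∫ x in Ω, beta γ (fn y x) * fn v x) = u v

end SemilinearVI

end

/-!
The function `β_γ` is an `ε`-subgradient of the absolute value with `ε = 2 / (π γ)`, that is,
`|s| + β_γ(s) (t - s) ≤ |t| + ε`.  Test the variational inequality with `y_γ` and the regularized
equation with `y_γ - y`, and add: the `L¹` terms cancel up to `ε |Ω|`, which leaves
`a(y_γ - y, y_γ - y) ≤ ‖u_γ - u‖ ‖y_γ - y‖ + ε |Ω|`.  The Poincaré inequality makes `a` coercive,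
and `y_γ → y` in the norm of `H₀¹(Ω)` follows.  It holds on every `Ω` contained in a strip
`|ℓ| ≤ R` with `ℓ` linear and `ℓ e = 1`: since `∂ₑℓ = 1`, integration by parts gives
`∫ φ² = -2 ∫ φ ∂ₑφ ℓ`, and Young's inequality absorbs `φ` into the left-hand side.
-/

namespace SemilinearVI

section Poincare

section FiniteDimensional

variable {E : Type*} [NormedAddCommGroup E] [NormedSpace ℝ E] [FiniteDimensional ℝ E]
  [MeasurableSpace E] [BorelSpace E] {μ : Measure E} [μ.IsAddHaarMeasure]
  {φ : E → ℝ} {e : E} {ℓ : E →L[ℝ] ℝ}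

theorem integral_sq_eq_neg_integral_mul_fderiv (hφ : ContDiff ℝ 1 φ) (hφc : HasCompactSupport φ)
    (hℓ : ℓ e = 1) :
    ∫ x, φ x ^ 2 ∂μ = -∫ x, φ x * (2 * fderiv ℝ φ x e * ℓ x) ∂μ := by
  have hφd : Differentiable ℝ φ := hφ.differentiable one_ne_zero
  have : Continuous (fderiv ℝ φ) := hφ.continuous_fderiv one_ne_zero
  have hsq (x : E) : fderiv ℝ (fun z => φ z ^ 2) x e * ℓ x =
      φ x * (2 * fderiv ℝ φ x e * ℓ x) := by
    simp only [fderiv_fun_pow 2 (hφd x), smul_apply, smul_eq_mul, nsmul_eq_mul]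
    ring
  have hℓ' (x : E) : φ x ^ 2 * fderiv ℝ ℓ x e = φ x * φ x := by
    rw [ℓ.fderiv, hℓ, mul_one, sq]
  have hint : Integrable (fun x => φ x * φ x) μ :=
    (by fun_prop : Continuous fun x => φ x * φ x).integrable_of_hasCompactSupport hφc.mul_right
  have hint' : Integrable (fun x => φ x * (2 * fderiv ℝ φ x e * ℓ x)) μ :=
    (by fun_prop : Continuous fun x => φ x * (2 * fderiv ℝ φ x e * ℓ x))
      |>.integrable_of_hasCompactSupport hφc.mul_right
  have hintℓ : Integrable (fun x => φ x * (φ x * ℓ x)) μ :=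
    (by fun_prop : Continuous fun x => φ x * (φ x * ℓ x))
      |>.integrable_of_hasCompactSupport hφc.mul_right
  have hparts := integral_mul_fderiv_eq_neg_fderiv_mul_of_integrable (μ := μ) (v := e)
    (f := fun x => φ x ^ 2) (g := ℓ) (by simpa only [hsq] using hint')
    (by simpa only [hℓ'] using hint) (by simpa only [sq, mul_assoc] using hintℓ)
    (fun x _ => (hφd x).pow 2) (fun x _ => ℓ.differentiableAt)
  simpa only [hsq, hℓ', ← sq] using hparts

theorem integral_sq_le_integral_fderiv_apply_sq (hφ : ContDiff ℝ 1 φ) (hφc : HasCompactSupport φ)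
    (hℓ : ℓ e = 1) {R : ℝ} (hR : ∀ x ∈ Function.support φ, |ℓ x| ≤ R) :
    ∫ x, φ x ^ 2 ∂μ ≤ (2 * R) ^ 2 * ∫ x, fderiv ℝ φ x e ^ 2 ∂μ := by
  have : Continuous (fderiv ℝ φ) := hφ.continuous_fderiv one_ne_zero
  have hint : Integrable (fun x => φ x ^ 2) μ :=
    (by fun_prop : Continuous fun x => φ x ^ 2).integrable_of_hasCompactSupport
      (hφc.comp_left (g := fun t : ℝ => t ^ 2) (by simp))
  have hint' : Integrable (fun x => fderiv ℝ φ x e ^ 2) μ :=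
    (by fun_prop : Continuous fun x => fderiv ℝ φ x e ^ 2).integrable_of_hasCompactSupport
      ((hφc.fderiv_apply ℝ e).comp_left (g := fun t : ℝ => t ^ 2) (by simp))
  have hintℓ : Integrable (fun x => φ x * (2 * fderiv ℝ φ x e * ℓ x)) μ :=
    (by fun_prop : Continuous fun x => φ x * (2 * fderiv ℝ φ x e * ℓ x))
      |>.integrable_of_hasCompactSupport hφc.mul_right
  have hyoung (x : E) : -(φ x * (2 * fderiv ℝ φ x e * ℓ x)) ≤
      2⁻¹ * φ x ^ 2 + 2 * R ^ 2 * fderiv ℝ φ x e ^ 2 := by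
    by_cases hx : φ x = 0
    · rw [hx, zero_mul, neg_zero]
      positivity
    · have hℓR : ℓ x ^ 2 ≤ R ^ 2 := sq_le_sq' (abs_le.1 (hR x hx)).1 (abs_le.1 (hR x hx)).2
      nlinarith [sq_nonneg (φ x + 2 * (fderiv ℝ φ x e * ℓ x)),
        mul_le_mul_of_nonneg_left hℓR (sq_nonneg (fderiv ℝ φ x e))]
  have habsorb : ∫ x, φ x ^ 2 ∂μ ≤
      2⁻¹ * ∫ x, φ x ^ 2 ∂μ + 2 * R ^ 2 * ∫ x, fderiv ℝ φ x e ^ 2 ∂μ := by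
    calc ∫ x, φ x ^ 2 ∂μ = ∫ x, -(φ x * (2 * fderiv ℝ φ x e * ℓ x)) ∂μ := by
          rw [integral_neg, integral_sq_eq_neg_integral_mul_fderiv hφ hφc hℓ]
      _ ≤ ∫ x, 2⁻¹ * φ x ^ 2 + 2 * R ^ 2 * fderiv ℝ φ x e ^ 2 ∂μ :=
          integral_mono hintℓ.neg ((hint.const_mul _).add (hint'.const_mul _)) hyoung
      _ = 2⁻¹ * ∫ x, φ x ^ 2 ∂μ + 2 * R ^ 2 * ∫ x, fderiv ℝ φ x e ^ 2 ∂μ := by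
          rw [integral_add (hint.const_mul _) (hint'.const_mul _), integral_const_mul,
            integral_const_mul]
  linarith

end FiniteDimensional

theorem integral_sq_le_integral_norm_gradient_sq {E : Type*} [NormedAddCommGroup E]
    [InnerProductSpace ℝ E] [FiniteDimensional ℝ E] [MeasurableSpace E] [BorelSpace E]
    {μ : Measure E} [μ.IsAddHaarMeasure] {φ : E → ℝ} (hφ : ContDiff ℝ 1 φ)
    (hφc : HasCompactSupport φ) {e : E} (he : ‖e‖ = 1) {R : ℝ}
    (hR : ∀ x ∈ Function.support φ, |inner ℝ e x| ≤ R) :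
    ∫ x, φ x ^ 2 ∂μ ≤ (2 * R) ^ 2 * ∫ x, ‖∇ φ x‖ ^ 2 ∂μ := by
  have : Continuous (fderiv ℝ φ) := hφ.continuous_fderiv one_ne_zero
  have hnorm (x : E) : ‖∇ φ x‖ = ‖fderiv ℝ φ x‖ := LinearIsometryEquiv.norm_map _ _
  have hdir (x : E) : fderiv ℝ φ x e ^ 2 ≤ ‖∇ φ x‖ ^ 2 := by
    rw [hnorm, ← sq_abs]
    gcongr
    exact (fderiv ℝ φ x).unit_le_opNorm e he.le
  have hint : Integrable (fun x => ‖∇ φ x‖ ^ 2) μ := by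
    simp only [hnorm]
    exact (by fun_prop : Continuous fun x => ‖fderiv ℝ φ x‖ ^ 2).integrable_of_hasCompactSupport
      ((hφc.fderiv ℝ).comp_left (g := fun L : E →L[ℝ] ℝ => ‖L‖ ^ 2) (by simp))
  calc ∫ x, φ x ^ 2 ∂μ ≤ (2 * R) ^ 2 * ∫ x, fderiv ℝ φ x e ^ 2 ∂μ :=
        integral_sq_le_integral_fderiv_apply_sq (ℓ := innerSL ℝ e) hφ hφc (by simp [he]) hR
    _ ≤ (2 * R) ^ 2 * ∫ x, ‖∇ φ x‖ ^ 2 ∂μ := by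
        refine mul_le_mul_of_nonneg_left ?_ (sq_nonneg _)
        exact integral_mono_of_nonneg (ae_of_all _ fun x => sq_nonneg _) hint (ae_of_all _ hdir)

theorem norm_sq_eq_integral_of_ae_eq {α F : Type*} [MeasurableSpace α] {μ : Measure α}
    [NormedAddCommGroup F] [InnerProductSpace ℝ F] {s : Set α} {g : Lp F 2 (μ.restrict s)}
    {f : α → F} (hg : g =ᵐ[μ.restrict s] f) (hf : ∀ x ∉ s, f x = 0) :
    ‖g‖ ^ 2 = ∫ x, ‖f x‖ ^ 2 ∂μ := by
  calc ‖g‖ ^ 2 = ∫ x in s, ‖g x‖ ^ 2 ∂μ := by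
        simp only [← real_inner_self_eq_norm_sq, L2.inner_def]
    _ = ∫ x in s, ‖f x‖ ^ 2 ∂μ := integral_congr_ae (hg.mono fun x hx => by simp only [hx])
    _ = ∫ x, ‖f x‖ ^ 2 ∂μ :=
        setIntegral_eq_integral_of_forall_compl_eq_zero fun x hx => by simp [hf x hx]

variable {d : ℕ} {Ω : Set (EuclideanSpace ℝ (Fin d))} {e : EuclideanSpace ℝ (Fin d)} {R : ℝ}

theorem norm_fst_sq_le_of_mem_testPairs (he : ‖e‖ = 1) (hR : ∀ x ∈ Ω, |inner ℝ e x| ≤ R)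
    {w : L2Pair Ω} (hw : w ∈ testPairs Ω) : ‖w.fst‖ ^ 2 ≤ (2 * R) ^ 2 * ‖w.snd‖ ^ 2 := by
  obtain ⟨φ, hφ, hφc, hφΩ, hfst, hsnd⟩ := hw
  have hφ0 (x) (hx : x ∉ Ω) : φ x = 0 := image_eq_zero_of_notMem_tsupport fun h => hx (hφΩ h)
  have hgrad0 (x) (hx : x ∉ Ω) : ∇ φ x = 0 := by
    have hfderiv : fderiv ℝ φ x = 0 :=
      Function.notMem_support.1 fun h => hx (hφΩ (support_fderiv_subset ℝ h))
    rw [gradient, hfderiv, map_zero]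
  rw [norm_sq_eq_integral_of_ae_eq hfst hφ0, norm_sq_eq_integral_of_ae_eq hsnd hgrad0]
  simp only [Real.norm_eq_abs, sq_abs]
  exact integral_sq_le_integral_norm_gradient_sq (hφ.of_le (by norm_cast)) hφc he
    fun x hx => hR x (hφΩ (subset_tsupport φ hx))

theorem norm_fn_sq_le (he : ‖e‖ = 1) (hR : ∀ x ∈ Ω, |inner ℝ e x| ≤ R) (y : H10 Ω) :
    ‖fn y‖ ^ 2 ≤ (2 * R) ^ 2 * ‖weakGrad y‖ ^ 2 := by
  have hclosed : IsClosed {w : L2Pair Ω | ‖w.fst‖ ^ 2 ≤ (2 * R) ^ 2 * ‖w.snd‖ ^ 2} :=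
    isClosed_le (by fun_prop) (by fun_prop)
  exact closure_minimal (fun w hw => norm_fst_sq_le_of_mem_testPairs he hR hw) hclosed y.2

theorem dirichletForm_eq_inner (y v : H10 Ω) :
    dirichletForm y v = inner ℝ (weakGrad y) (weakGrad v) := rfl

theorem norm_sq_le_mul_dirichletForm (he : ‖e‖ = 1) (hR : ∀ x ∈ Ω, |inner ℝ e x| ≤ R)
    (y : H10 Ω) : ‖y‖ ^ 2 ≤ ((2 * R) ^ 2 + 1) * dirichletForm y y := by
  have hnorm : ‖y‖ ^ 2 = ‖fn y‖ ^ 2 + ‖weakGrad y‖ ^ 2 :=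
    WithLp.prod_norm_sq_eq_of_L2 (y : L2Pair Ω)
  rw [hnorm, dirichletForm_eq_inner, real_inner_self_eq_norm_sq]
  linarith [norm_fn_sq_le he hR y]

end Poincare

section Beta

theorem arctan_le_self {x : ℝ} (hx : 0 ≤ x) : Real.arctan x ≤ x := by
  simpa only [Real.tan_arctan] using
    Real.le_tan (Real.arctan_nonneg.2 hx) (Real.arctan_lt_pi_div_two x)

theorem abs_beta_le_one (γ s : ℝ) : |beta γ s| ≤ 1 := by
  have harctan : |Real.arctan (γ * s)| ≤ Real.pi / 2 :=
    abs_le.2 ⟨(Real.neg_pi_div_two_lt_arctan _).le, (Real.arctan_lt_pi_div_two _).le⟩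
  calc |beta γ s| = 2 / Real.pi * |Real.arctan (γ * s)| := by
        rw [beta, abs_mul, abs_of_pos (by positivity)]
    _ ≤ 2 / Real.pi * (Real.pi / 2) := by gcongr
    _ = 1 := by field_simp

theorem beta_neg (γ s : ℝ) : beta γ (-s) = -beta γ s := by
  simp only [beta, mul_neg, Real.arctan_neg]

theorem continuous_beta (γ : ℝ) : Continuous (beta γ) := by
  unfold beta
  fun_prop

variable {γ : ℝ}

theorem abs_le_beta_mul_self_add (hγ : 0 < γ) (s : ℝ) :
    |s| ≤ beta γ s * s + 2 / (Real.pi * γ) := by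
  wlog hs : 0 ≤ s generalizing s
  · simpa only [abs_neg, beta_neg, neg_mul_neg] using this (-s) (by linarith)
  rcases hs.eq_or_lt with rfl | hs
  · rw [abs_zero, mul_zero, zero_add]
    positivity
  have hγs : 0 < γ * s := mul_pos hγ hs
  have hbeta : beta γ s = 1 - 2 / Real.pi * Real.arctan (γ * s)⁻¹ := by
    rw [Real.arctan_inv_of_pos hγs, beta]
    field_simp
    ring
  have hrem : 2 / Real.pi * Real.arctan (γ * s)⁻¹ * s ≤ 2 / (Real.pi * γ) := by
    calc 2 / Real.pi * Real.arctan (γ * s)⁻¹ * s ≤ 2 / Real.pi * (γ * s)⁻¹ * s := by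
          gcongr
          exact arctan_le_self (inv_nonneg.2 hγs.le)
      _ = 2 / (Real.pi * γ) := by field_simp
  rw [abs_of_pos hs, hbeta]
  linarith

theorem abs_sub_abs_le_beta_mul_sub_add (hγ : 0 < γ) (s t : ℝ) :
    |s| - |t| ≤ beta γ s * (s - t) + 2 / (Real.pi * γ) := by
  have hself := abs_le_beta_mul_self_add hγ s
  have hcross : beta γ s * t ≤ |t| := by
    refine (le_abs_self _).trans ?_
    rw [abs_mul]
    exact mul_le_of_le_one_left (abs_nonneg t) (abs_beta_le_one γ s)
  linarith

theorem integral_abs_sub_le_integral_beta_mul_sub_add {α : Type*} [MeasurableSpace α]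
    {μ : Measure α} [IsFiniteMeasure μ] {f g : α → ℝ} (hγ : 0 < γ) (hf : Integrable f μ)
    (hg : Integrable g μ) :
    ∫ x, |f x| ∂μ - ∫ x, |g x| ∂μ ≤
      ∫ x, beta γ (f x) * (f x - g x) ∂μ + 2 / (Real.pi * γ) * μ.real Set.univ := by
  have hbeta : Integrable (fun x => beta γ (f x) * (f x - g x)) μ :=
    (hf.sub hg).bdd_mul (c := 1)
      ((continuous_beta γ).comp_aestronglyMeasurable hf.aestronglyMeasurable)
      (ae_of_all _ fun x => abs_beta_le_one γ (f x))
  calc ∫ x, |f x| ∂μ - ∫ x, |g x| ∂μ = ∫ x, |f x| - |g x| ∂μ :=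
        (integral_sub hf.abs hg.abs).symm
    _ ≤ ∫ x, beta γ (f x) * (f x - g x) + 2 / (Real.pi * γ) ∂μ :=
        integral_mono (hf.abs.sub hg.abs) (hbeta.add (integrable_const _))
          fun x => abs_sub_abs_le_beta_mul_sub_add hγ (f x) (g x)
    _ = ∫ x, beta γ (f x) * (f x - g x) ∂μ + 2 / (Real.pi * γ) * μ.real Set.univ := by
        rw [integral_add hbeta (integrable_const _), integral_const, smul_eq_mul,
          mul_comm (μ.real _)]

end Beta

section Estimate

variable {d : ℕ} {Ω : Set (EuclideanSpace ℝ (Fin d))} [IsFiniteMeasure (volume.restrict Ω)]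
  {γ : ℝ} {u u₀ : Hm1 Ω} {y y₀ : H10 Ω}

theorem integrable_fn (y : H10 Ω) : Integrable (fn y) (volume.restrict Ω) :=
  (Lp.memLp (fn y)).integrable one_le_two

theorem l1Norm_sub_le_integral_beta_mul_fn_add (hγ : 0 < γ) (y z : H10 Ω) :
    l1Norm y - l1Norm z ≤
      (∫ x in Ω, beta γ (fn y x) * fn (y - z) x) + 2 / (Real.pi * γ) * volume.real Ω := by
  have hsub : fn (y - z) =ᵐ[volume.restrict Ω] fn y - fn z := Lp.coeFn_sub (fn y) (fn z)
  have hcongr : ∫ x in Ω, beta γ (fn y x) * fn (y - z) x =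
      ∫ x in Ω, beta γ (fn y x) * (fn y x - fn z x) :=
    integral_congr_ae (hsub.mono fun x hx => by simp only [hx, Pi.sub_apply])
  rw [hcongr, ← measureReal_restrict_apply_univ]
  exact integral_abs_sub_le_integral_beta_mul_sub_add hγ (integrable_fn y) (integrable_fn z)

theorem dirichletForm_sub_self_le (hγ : 0 < γ) (hy : IsRegularizedSolution γ u y)
    (hy₀ : IsVISolution u₀ y₀) :
    dirichletForm (y - y₀) (y - y₀) ≤
      ‖u - u₀‖ * ‖y - y₀‖ + 2 / (Real.pi * γ) * volume.real Ω := by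
  have hequation := hy (y - y₀)
  have hinequality := hy₀ y
  have hl1 := l1Norm_sub_le_integral_beta_mul_fn_add hγ y y₀
  have hlinear : dirichletForm (y - y₀) (y - y₀) =
      dirichletForm y (y - y₀) - dirichletForm y₀ (y - y₀) :=
    inner_sub_left (weakGrad y) (weakGrad y₀) (weakGrad (y - y₀))
  have hdual : u (y - y₀) - u₀ (y - y₀) ≤ ‖u - u₀‖ * ‖y - y₀‖ :=
    (le_abs_self _).trans ((u - u₀).le_opNorm (y - y₀))
  linarith

theorem norm_sub_sq_le {C : ℝ} (hC : 0 ≤ C)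
    (hcoercive : ∀ v : H10 Ω, ‖v‖ ^ 2 ≤ C * dirichletForm v v) (hγ : 0 < γ)
    (hy : IsRegularizedSolution γ u y) (hy₀ : IsVISolution u₀ y₀) :
    ‖y - y₀‖ ^ 2 ≤ C ^ 2 * ‖u - u₀‖ ^ 2 + 4 * C / Real.pi * volume.real Ω * γ⁻¹ := by
  have hbound : ‖y - y₀‖ ^ 2 ≤
      C * ‖u - u₀‖ * ‖y - y₀‖ + 2 * C / Real.pi * volume.real Ω * γ⁻¹ := by
    calc ‖y - y₀‖ ^ 2 ≤ C * dirichletForm (y - y₀) (y - y₀) := hcoercive (y - y₀)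
      _ ≤ C * (‖u - u₀‖ * ‖y - y₀‖ + 2 / (Real.pi * γ) * volume.real Ω) := by
          gcongr
          exact dirichletForm_sub_self_le hγ hy hy₀
      _ = C * ‖u - u₀‖ * ‖y - y₀‖ + 2 * C / Real.pi * volume.real Ω * γ⁻¹ := by
          field_simp
  linear_combination 2 * hbound + sq_nonneg (C * ‖u - u₀‖ - ‖y - y₀‖)

end Estimate

theorem tendsto_of_norm_sub_sq_le {E ι : Type*} [SeminormedAddCommGroup E] {l : Filter ι}
    {f : ι → E} {a : E} {r : ι → ℝ} (h : ∀ᶠ i in l, ‖f i - a‖ ^ 2 ≤ r i)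
    (hr : Tendsto r l (𝓝 0)) : Tendsto f l (𝓝 a) := by
  have hsq : Tendsto (fun i => ‖f i - a‖ ^ 2) l (𝓝 0) :=
    squeeze_zero' (Eventually.of_forall fun i => sq_nonneg ‖f i - a‖) h hr
  exact tendsto_iff_norm_sub_tendsto_zero.2 (by simpa using hsq.sqrt)

end SemilinearVI

theorem theoremA1_general {d : ℕ} {Ω : Set (EuclideanSpace ℝ (Fin d))} (hΩ : volume Ω ≠ ⊤)
    {e : EuclideanSpace ℝ (Fin d)} (he : ‖e‖ = 1) {R : ℝ} (hR : ∀ x ∈ Ω, |inner ℝ e x| ≤ R)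
    {ι : Type*} {l : Filter ι} {γ : ι → ℝ} (hγ : Tendsto γ l atTop)
    {u : ι → SemilinearVI.Hm1 Ω} {u₀ : SemilinearVI.Hm1 Ω} (hu : Tendsto u l (𝓝 u₀))
    {y : ι → SemilinearVI.H10 Ω}
    (hy : ∀ᶠ i in l, SemilinearVI.IsRegularizedSolution (γ i) (u i) (y i))
    {y₀ : SemilinearVI.H10 Ω} (hy₀ : SemilinearVI.IsVISolution u₀ y₀) :
    Tendsto y l (𝓝 y₀) := by
  have : IsFiniteMeasure (volume.restrict Ω) := isFiniteMeasure_restrict.2 hΩ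
  set C := (2 * R) ^ 2 + 1
  have hestimate : ∀ᶠ i in l, ‖y i - y₀‖ ^ 2 ≤
      C ^ 2 * ‖u i - u₀‖ ^ 2 + 4 * C / Real.pi * volume.real Ω * (γ i)⁻¹ := by
    filter_upwards [hy, hγ.eventually_gt_atTop 0] with i hyi hγi
    exact SemilinearVI.norm_sub_sq_le (by positivity)
      (SemilinearVI.norm_sq_le_mul_dirichletForm he hR) hγi hyi hy₀
  have hdual : Tendsto (fun i => ‖u i - u₀‖) l (𝓝 0) :=
    (tendsto_iff_norm_sub_tendsto_zero (E := SemilinearVI.Hm1 Ω)).1 hu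
  have hlimit : Tendsto (fun i => C ^ 2 * ‖u i - u₀‖ ^ 2 +
      4 * C / Real.pi * volume.real Ω * (γ i)⁻¹) l (𝓝 0) := by
    simpa using ((hdual.pow 2).const_mul (C ^ 2)).add
      (hγ.inv_tendsto_atTop.const_mul (4 * C / Real.pi * volume.real Ω))
  exact SemilinearVI.tendsto_of_norm_sub_sq_le hestimate hlimit

theorem theoremA1 {d : ℕ} (hd : 1 ≤ d) (Ω : Set (EuclideanSpace ℝ (Fin d)))
    (hΩ : IsOpen Ω) (hΩb : Bornology.IsBounded Ω)
    {ι : Type*} (l : Filter ι) (γ : ι → ℝ) (hγ : Tendsto γ l atTop)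
    (u : ι → SemilinearVI.Hm1 Ω) (u₀ : SemilinearVI.Hm1 Ω) (hu : Tendsto u l (𝓝 u₀))
    (y : ι → SemilinearVI.H10 Ω)
    (hy : ∀ᶠ i in l, SemilinearVI.IsRegularizedSolution (γ i) (u i) (y i))
    (y₀ : SemilinearVI.H10 Ω) (hy₀ : SemilinearVI.IsVISolution u₀ y₀) :
    Tendsto y l (𝓝 y₀) := by
  obtain ⟨R, hR⟩ := hΩb.exists_norm_le
  exact theoremA1_general hΩb.measure_lt_top.ne (e := EuclideanSpace.single ⟨0, hd⟩ 1) (by simp)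
    (fun x hx => (abs_real_inner_le_norm _ x).trans (by simpa using hR x hx)) hγ hu hy hy₀
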